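/- **Theorem 2.** Fix numbers $M,T,n_a,n_1,\dots,n_M$ and $l_i,l_f\ge 0$; put $l=l_i+l_f$, $n=\max_i n_i$, $L=\lceil\log_2 n\rceil+\lceil\log_2 M\rceil$ (with $\lceil\log_2 0\rceil:=0$). Data are rationals $y$ with $\bar y:=2^{l_f}y\in[-2^{l-1},2^{l-1})\cap\mathbb Z$. For the statistical security parameter $\lambda$ put $$\gamma=2l+1+L,\qquad \delta=\max(l+2+L,\lambda)+3l+4+2L,\qquad \tilde y=\bar y+2^\gamma .$$ The packed scheme $\mathrm{pWSAh}^\ast$ for $\sum_{i=1}^M W_ix_i(t)$, with $W_i$ of size $n_a\times n_i$ and $x_i(t)$ of size $n_i$, is the following. * $\mathrm{Setup}(1^\kappa)$: generate primes $p,q$ of equal bit length with $N=pq$, $\lfloor\log_2N\rfloor=\kappa$, $\gcd(\phi(N),N)=1$. The Paillier public key is $N$, the secret key is $(\phi(N),\phi(N)^{-1}\bmod N)$, and $\mathrm E(y)=(1+N)^y r^N\bmod N^2$ with fresh uniform $r\in(\mathbb Z/N\mathbb Z)^\ast$. For all $t\in[T]$, $k\in[n_a]$, $i\in[M]$ choose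 independent uniform shares $s_i^{[k]}(t)\in\mathbb Z/2^\gamma\mathbb Z$ (identified with $\{0,\dots,2^\gamma-1\}$), and put $s_a^{[k]}(t)=-\sum_i s_i^{[k]}(t)\in\mathbb Z/2^\gamma\mathbb Z$. Agent $i$ gets $\mathrm{sk}_i=(s_i(t))_t$, and the aggregator gets the Paillier secret key and $(s_a(t))_t$. * Packing: with $m=\max(1,\lfloor\lfloor\log_2N\rfloor/\delta\rfloor)$, a vector of $n_a$ nonnegative integers is cut into $\lceil n_a/m\rceil$ blocks of at most $m$ consecutive entries, and a block $(y_1,y_2,\dots)$ becomes the plaintext $\sum_j y_j2^{(j-1)\delta}$. * $\mathrm{InitW}(W_i)$: encrypt the packed columns of $(\tilde W_i^{[kc]})$. * $\mathrm{Enc}$: with fresh uniform $z^{[k]}\in\{0,\dots,2^{l+1+\lambda+\lceil\log_2n_i\rceil}-1\}$, agent $i$ outputs, for each block, $\prod_c \mathrm E(W_i^{c})^{\tilde x_i^{[c]}(t)}\cdot \mathrm E(\text{packed } s_i^{[k]}(t)+2^\gamma z^{[k]})\bmod N^2$. * $\mathrm{AggrDec}$: multiply the agents' ciphertexts, decrypt,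 add the packed $s_a(t)$, split into slots of $\delta$ bits, take the representative of each slot modulo $2^\gamma$ in $[-2^{\gamma-1},2^{\gamma-1})$, and divide by $2^{2l_f}$. Let keys be drawn by any generator as above (a distribution on keys for each $\kappa$ whose keys satisfy $\lfloor\log_2 N\rfloor=\kappa$ whenever such keys exist), and let $\lambda=\lambda(\kappa)$ be such that $2^{-\lambda(\kappa)}$ is negligible. Then: 1. (Correctness) Whenever $\delta\le\lfloor\log_2N\rfloor$, for all weights, data and time steps and all random choices of $\mathrm{Setup}$, $\mathrm{InitW}$, $\mathrm{Enc}$, the output of $\mathrm{AggrDec}$ is exactly $\sum_iW_ix_i(t)$. 2. (Aggregator obliviousness) Every family of probabilistic adversaries, of any running time (in particular every probabilistic polynomial-time one), has advantage $|\Pr[b'=b]-\tfrac12|\le\eta(\kappa)$ with $\eta$ negligible in the following game. The challenger runs $\mathrm{Setup}$, publishes $\kappa$ and $N$, and draws $b\in\{0,1\}$ uniformly. The adversary makes, adaptively: compromise queries for agents or the aggregator, answered by the secret key of that participant; at most one encryption query $(i,t,W_i^0,W_i^1,x_i(t))$ for each $(i,t)$, answered by $\mathrm{Enc}(\mathrm{InitW}(W_i^\beta),\mathrm{sk}_i,t,x_i(t))$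 for $\beta=0$ and $\beta=1$; and exactly one challenge, which consists of a time $t^\ast$, a set of participants $S^\ast$, and $W_i^0,W_i^1,x_i^0(t^\ast),x_i^1(t^\ast)$ for the agents $i\in S^\ast$, answered by $\mathrm{Enc}(\mathrm{InitW}(W_i^b),\mathrm{sk}_i,t^\ast,x_i^b(t^\ast))$ for these agents. It uses the same pair $W_i^0,W_i^1$ for agent $i$ throughout, and finally outputs $b'$. With $U^\ast$ the set of participants that were never compromised and for which no encryption query was made at time $t^\ast$, it must respect $S^\ast\subseteq U^\ast$ and, if $S^\ast=U^\ast$ does not contain the aggregator, $\sum_{i\in S^\ast}W_i^0x_i^0(t^\ast)=\sum_{i\in S^\ast}W_i^1x_i^1(t^\ast)$. If it breaks a rule, $b'$ is replaced by a fair coin. -/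

import Mathlib

open scoped BigOperators

namespace PackedWSA

/-! ## Dimensions, fixed-point data, packing parameters -/

/-- The public dimensions: `M` agents, time steps `0, …, T-1`, aggregate of dimension `na`, local
data of agent `i` of dimension `n i`, and fixed-point numbers with `li` integer bits (including the
sign) and `lf` fractional bits. -/
structure System where
  M : ℕ
  T : ℕ
  na : ℕ
  n : Fin M → ℕ
  li : ℕ
  lf : ℕ

namespace System

variable (D : System)

/-- Message size in bits. -/
def l : ℕ := D.li + D.lf

/-- The largest local dimension. -/
def nMax : ℕ := Finset.univ.sup D.n

/-- The offset exponent `γ = 2l + 1 + ⌈log₂ n⌉ + ⌈log₂ M⌉`. -/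
def gam : ℕ := 2 * D.l + 1 + Nat.clog 2 D.nMax + Nat.clog 2 D.M

/-- The slot width
`δ = max (l + 2 + ⌈log₂ n⌉ + ⌈log₂ M⌉, λ) + 3l + 4 + 2 (⌈log₂ n⌉ + ⌈log₂ M⌉)`. -/
def del (lam : ℕ) : ℕ :=
  max (D.l + 2 + Nat.clog 2 D.nMax + Nat.clog 2 D.M) lam
    + 3 * D.l + 4 + 2 * (Nat.clog 2 D.nMax + Nat.clog 2 D.M)

/-- Bit length `l + 1 + λ + ⌈log₂ nᵢ⌉` of the noise `z` of agent `i`. -/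
def noiseBits (lam : ℕ) (i : Fin D.M) : ℕ := D.l + 1 + lam + Nat.clog 2 (D.n i)

/-- Rationals `y` for which `2 ^ lf * y` is an integer in `[-2 ^ (l-1), 2 ^ (l-1))`. -/
def FixedPt : Type :=
  {y : ℚ // ∃ a : ℤ, -2 ^ D.l ≤ 2 * a ∧ 2 * a < 2 ^ D.l ∧ y * 2 ^ D.lf = a}

/-- Weight matrices for agent `i`. -/
abbrev Weights (i : Fin D.M) : Type := Matrix (Fin D.na) (Fin (D.n i)) D.FixedPt

/-- Local data of agent `i` at one time step. -/
abbrev Data (i : Fin D.M) : Type := Fin (D.n i) → D.FixedPt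

variable {D}

/-- The integer `ȳ = y * 2 ^ lf`. -/
def bar (y : D.FixedPt) : ℤ := ⌊y.1 * 2 ^ D.lf⌋

/-- The nonnegative integer `ỹ = ȳ + 2 ^ γ`. -/
def tilde (y : D.FixedPt) : ℕ := (bar y + 2 ^ D.gam).toNat

/-- The exact product `W x` over the rationals. -/
def apply {i : Fin D.M} (W : D.Weights i) (x : D.Data i) : Fin D.na → ℚ :=
  (W.map fun a => a.1).mulVec fun c => (x c).1

end System

/-! ## The Paillier cryptosystem -/

/-- Paillier key material: two primes of equal bit length with `gcd (φ N, N) = 1`, `N = p q`. -/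
structure PaillierKey where
  p : ℕ
  q : ℕ
  hp : p.Prime
  hq : q.Prime
  equalSize : Nat.log 2 p = Nat.log 2 q
  coprime : Nat.Coprime (Nat.totient (p * q)) (p * q)

namespace PaillierKey

/-- The modulus, which is the public key. -/
def N (K : PaillierKey) : ℕ := K.p * K.q

/-- `⌊log₂ N⌋`. -/
def bits (K : PaillierKey) : ℕ := Nat.log 2 K.N

instance (K : PaillierKey) : NeZero K.N := ⟨Nat.mul_ne_zero K.hp.ne_zero K.hq.ne_zero⟩

end PaillierKey

/-- The secret key `(φ(N), φ(N)⁻¹ mod N)`. -/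
def secretKey (K : PaillierKey) : ℕ × ZMod K.N :=
  (Nat.totient K.N, ((Nat.totient K.N : ℕ) : ZMod K.N)⁻¹)

/-- `E(x) = (1 + N) ^ x * r ^ N mod N ^ 2`, with randomness `r ∈ (ℤ/Nℤ)ˣ`. -/
def encryptP (N : ℕ) (x : ℕ) (r : (ZMod N)ˣ) : ZMod (N ^ 2) :=
  (1 + (N : ZMod (N ^ 2))) ^ x * ((r : ZMod N).val : ZMod (N ^ 2)) ^ N

/-- `D(c) = (c ^ φ(N) - 1) / N * φ(N)⁻¹ mod N`. -/
def decryptP (N : ℕ) (sk : ℕ × ZMod N) (c : ZMod (N ^ 2)) : ZMod N :=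
  ((((c ^ sk.1).val - 1) / N : ℕ) : ZMod N) * sk.2

/-- A key generator: for each security parameter `κ`, a distribution on Paillier keys, which
outputs keys with `⌊log₂ N⌋ = κ` whenever there are such keys. -/
def IsKeyGenerator (gen : ℕ → PMF PaillierKey) : Prop :=
  ∀ κ, (∃ K : PaillierKey, K.bits = κ) → ∀ K ∈ (gen κ).support, K.bits = κ

/-! ## Packing -/

section Packing

variable (D : System) (lam N : ℕ)

/-- The number of slots in one plaintext: the largest `m` with `m δ ≤ ⌊log₂ N⌋` (and `1` if there is
not even room for one slot, a case in which nothing is claimed about decryption). -/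
def capacity : ℕ := max 1 (Nat.log 2 N / D.del lam)

/-- The number `⌈na / m⌉` of plaintexts needed for a vector with `na` entries. -/
def blocks : ℕ := (D.na + capacity D lam N - 1) / capacity D lam N

theorem blockOf_lt (k : Fin D.na) :
    k.1 / capacity D lam N < blocks D lam N := by
  have hm : 0 < capacity D lam N := lt_of_lt_of_le Nat.one_pos (le_max_left _ _)
  have h : k.1 / capacity D lam N + 1 ≤ blocks D lam N := by
    unfold blocks
    rw [← Nat.add_div_right _ hm]
    exact Nat.div_le_div_right (by have := k.2; omega)
  exact h

/-- The plaintext that holds entry `k`. -/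
def blockOf (k : Fin D.na) : Fin (blocks D lam N) :=
  ⟨k.1 / capacity D lam N, blockOf_lt D lam N k⟩

/-- The position of the slot of entry `k` in its plaintext. -/
def slotOf (k : Fin D.na) : ℕ := k.1 % capacity D lam N

/-- Pack a vector of nonnegative integers into plaintexts with slots of width `δ`. -/
def pack (y : Fin D.na → ℕ) (β : Fin (blocks D lam N)) : ℕ :=
  ∑ k : Fin D.na, if blockOf D lam N k = β then y k * 2 ^ (slotOf D lam N k * D.del lam) else 0

/-- Read the slots of packed plaintexts. -/
def unpack (P : Fin (blocks D lam N) → ℕ) (k : Fin D.na) : ℕ :=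
  P (blockOf D lam N k) / 2 ^ (slotOf D lam N k * D.del lam) % 2 ^ D.del lam

/-! ## The scheme

Randomized algorithms are written as functions of explicit coins; the coins are uniform on their
type. -/

/-- Packed ciphertexts of a vector with `na` entries. -/
abbrev Cipher : Type := Fin (blocks D lam N) → ZMod (N ^ 2)

/-- A mask of each slot at each time step: the share of zero of one participant. -/
abbrev Shares : Type := Fin D.T → Fin D.na → ZMod (2 ^ D.gam)

/-- Coins of `Setup` (beyond key generation): the shares of the agents. -/
abbrev SetupCoins : Type := Fin D.M → Shares D

/-- Coins of `InitW` for agent `i`: Paillier randomness for each column and plaintext. -/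
abbrev InitCoins (i : Fin D.M) : Type := Fin (D.n i) → Fin (blocks D lam N) → (ZMod N)ˣ

/-- Coins of `Enc` for agent `i`: the noise `z` of each slot, and Paillier randomness. -/
abbrev EncCoins (i : Fin D.M) : Type :=
  (Fin D.na → Fin (2 ^ D.noiseBits lam i)) × (Fin (blocks D lam N) → (ZMod N)ˣ)

variable {D}

/-- The share of the aggregator: all shares together sum to zero in `ℤ/2^γℤ`. -/
def aggShares (s : SetupCoins D) : Shares D := fun t k => -∑ i, s i t k

/-- `InitW`: encryptions of the packed columns of the weight matrix of agent `i`. -/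
def initW {i : Fin D.M} (W : D.Weights i) (r : InitCoins D lam N i) :
    Fin (D.n i) → Cipher D lam N :=
  fun c β => encryptP N (pack D lam N (fun k => System.tilde (W k c)) β) (r c β)

/-- `Enc`: scalar multiplication of the encrypted columns, summation over the columns, and addition
of the packed masks `s + 2 ^ γ z`. -/
def enc {i : Fin D.M} (sw : Fin (D.n i) → Cipher D lam N) (sk : Shares D) (t : Fin D.T)
    (x : D.Data i) (r : EncCoins D lam N i) : Cipher D lam N :=
  fun β => (∏ c, sw c β ^ System.tilde (x c)) *
    encryptP N (pack D lam N (fun k => (sk t k).val + 2 ^ D.gam * (r.1 k).val) β) (r.2 β)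

/-- `AggrDec`: multiply the ciphertexts, decrypt, add the packed share of the aggregator, unpack,
reduce each slot modulo `2 ^ γ` to a signed residue in `[-2 ^ (γ-1), 2 ^ (γ-1))`, rescale. -/
def aggrDec (sk : ℕ × ZMod N) (sa : Shares D) (t : Fin D.T)
    (c : Fin D.M → Cipher D lam N) : Fin D.na → ℚ :=
  fun k =>
    let P := fun β =>
      (decryptP N sk (∏ i, c i β)).val + pack D lam N (fun k' => (sa t k').val) β
    (Int.bmod (unpack D lam N P k : ℤ) (2 ^ D.gam) : ℚ) / 2 ^ (2 * D.lf)

end Packing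

/-- Correctness: for every key whose plaintexts have room for at least one slot, the aggregator
recovers `∑ i, W i x i` exactly, whatever the coins of `Setup`, `InitW` and `Enc` are. -/
def IsCorrect (D : System) (gen : ℕ → PMF PaillierKey) (lam : ℕ → ℕ) : Prop :=
  ∀ κ, ∀ K ∈ (gen κ).support, D.del (lam κ) ≤ K.bits →
    ∀ (s : SetupCoins D) (W : ∀ i, D.Weights i) (rW : ∀ i, InitCoins D (lam κ) K.N i)
      (t : Fin D.T) (x : ∀ i, D.Data i) (r : ∀ i, EncCoins D (lam κ) K.N i),
      aggrDec (lam κ) K.N (secretKey K) (aggShares s) t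
        (fun i => enc (lam κ) K.N (initW (lam κ) K.N (W i) (rW i)) (s i) t (x i) (r i))
      = ∑ i, System.apply (W i) (x i)

/-! ## The aggregator obliviousness game

A participant is an `Option (Fin M)`: `some i` is agent `i`, and `none` is the aggregator. -/

/-- A challenge: a time step, a set of participants, and two series of weights and of data (only the
entries of agents in `S` are used). -/
structure Challenge (D : System) where
  t : Fin D.T
  S : Finset (Option (Fin D.M))
  W : Bool → ∀ i, D.Weights i
  x : Bool → ∀ i, D.Data i

/-- The queries of the adversary. -/
inductive Query (D : System) where
  | compromise (j : Option (Fin D.M))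
  | encrypt (i : Fin D.M) (t : Fin D.T) (W : Bool → D.Weights i) (x : D.Data i)
  | challenge (ch : Challenge D)

/-- The answers of the challenger, for a public modulus `N`. -/
inductive Answer (D : System) (lam N : ℕ) where
  | agentKey (sk : Shares D)
  | aggKey (sk : ℕ × ZMod N) (sa : Shares D)
  | ciphers (c : Bool → Cipher D lam N)
  | challenge (c : Fin D.M → Option (Cipher D lam N))

/-- The view of the adversary: the queries so far, in chronological order, with their answers. -/
abbrev History (D : System) (lam N : ℕ) : Type := List (Query D × Answer D lam N)

/-- A probabilistic adversary, not bounded in computing power. It sees the public modulus `N` and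
its view, asks adaptively at most `steps` queries (`none` means that it stops asking), and outputs a
guess. -/
structure Adversary (D : System) (lam : ℕ) where
  Coins : Type
  coins : PMF Coins
  steps : ℕ
  next : Coins → (N : ℕ) → History D lam N → Option (Query D)
  guess : Coins → (N : ℕ) → History D lam N → Bool

/-- The coins of the challenger: those of `Setup`, those of `InitW` and `Enc` for the two ciphertexts
of each encryption query (there is at most one for each agent and time step), and those of `InitW`
and `Enc` for each agent in the challenge. -/
abbrev Tape (D : System) (lam N : ℕ) : Type :=
  SetupCoins D ×
  (∀ i : Fin D.M, Fin D.T → Bool → InitCoins D lam N i × EncCoins D lam N i) ×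
  (∀ i : Fin D.M, InitCoins D lam N i × EncCoins D lam N i)

instance (D : System) (lam N : ℕ) [NeZero N] : Fintype (Tape D lam N) :=
  have : ∀ i : Fin D.M, Fintype (InitCoins D lam N i × EncCoins D lam N i) :=
    fun _ => inferInstance
  instFintypeProd _ _

/-- The answer of the challenger, who holds the challenge bit `b`. -/
def answer {D : System} (lam : ℕ) (K : PaillierKey) (b : Bool) (tape : Tape D lam K.N) :
    Query D → Answer D lam K.N
  | .compromise (some i) => .agentKey (tape.1 i)
  | .compromise none => .aggKey (secretKey K) (aggShares tape.1)
  | .encrypt i t W x => .ciphers fun β =>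
      let r := tape.2.1 i t β
      enc lam K.N (initW lam K.N (W β) r.1) (tape.1 i) t x r.2
  | .challenge ch => .challenge fun i =>
      let r := tape.2.2 i
      if some i ∈ ch.S then
        some (enc lam K.N (initW lam K.N (ch.W b i) r.1) (tape.1 i) ch.t (ch.x b i) r.2)
      else none

/-- The interaction: at most the given number of further queries, starting from a view. -/
def run {D : System} {lam : ℕ} (A : Adversary D lam) (ω : A.Coins) (K : PaillierKey) (b : Bool)
    (tape : Tape D lam K.N) : ℕ → History D lam K.N → History D lam K.N
  | 0, h => h
  | k + 1, h =>
    match A.next ω K.N h with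
    | none => h
    | some q => run A ω K b tape k (h ++ [(q, answer lam K b tape q)])

namespace Query

variable {D : System}

/-- The agent and time step of an encryption query. -/
def encIndex? : Query D → Option (Fin D.M × Fin D.T)
  | .encrypt i t _ _ => some (i, t)
  | _ => none

/-- The challenge, if the query is one. -/
def challenge? : Query D → Option (Challenge D)
  | .challenge ch => some ch
  | _ => none

/-- The query uses, for each agent that it involves, the given two weight matrices. -/
def UsesWeights (W : Bool → ∀ i, D.Weights i) : Query D → Prop
  | .compromise _ => True
  | .encrypt i _ W' _ => ∀ β, W' β = W β i
  | .challenge ch => ∀ i, some i ∈ ch.S → ∀ β, ch.W β i = W β i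

end Query

/-- `U*`: the participants that were not compromised in the whole game and for which no encryption
query was made at time `t`. -/
def uncorrupted {D : System} (qs : List (Query D)) (t : Fin D.T) : Set (Option (Fin D.M)) :=
  {j | Query.compromise j ∉ qs ∧ ∀ i, j = some i → (i, t) ∉ qs.filterMap Query.encIndex?}

/-- The rules of the game, for the list of all queries made: at most one encryption query for each
agent and time step; weights that are constant over the game; exactly one challenge; its set
satisfies `S* ⊆ U*`; and if `S* = U*` and the aggregator is not in `S*`, then the two challenge series
have the same aggregate. -/
def Legitimate {D : System} (qs : List (Query D)) : Prop :=
  (qs.filterMap Query.encIndex?).Nodup ∧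
  (∃ W : Bool → ∀ i, D.Weights i, ∀ q ∈ qs, q.UsesWeights W) ∧
  ∃ ch : Challenge D, qs.filterMap Query.challenge? = [ch] ∧
    (ch.S : Set (Option (Fin D.M))) ⊆ uncorrupted qs ch.t ∧
    ((ch.S : Set (Option (Fin D.M))) = uncorrupted qs ch.t → none ∉ ch.S →
      (∑ i with some i ∈ ch.S, System.apply (ch.W false i) (ch.x false i)) =
        ∑ i with some i ∈ ch.S, System.apply (ch.W true i) (ch.x true i))

open Classical in
/-- The game; the outcome `true` means that the guess is right. If the adversary breaks the rules, a
fair coin replaces its guess. -/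
noncomputable def game {D : System} {lam : ℕ} (gen : PMF PaillierKey) (A : Adversary D lam) :
    PMF Bool :=
  gen.bind fun K =>
  (PMF.uniformOfFintype Bool).bind fun b =>
  (PMF.uniformOfFintype (Tape D lam K.N)).bind fun tape =>
  A.coins.bind fun ω =>
    let h := run A ω K b tape A.steps []
    if Legitimate (h.map Prod.fst) then PMF.pure (A.guess ω K.N h == b)
    else PMF.uniformOfFintype Bool

/-- `|Pr[b' = b] - 1/2|`. -/
noncomputable def advantage {D : System} {lam : ℕ} (gen : PMF PaillierKey) (A : Adversary D lam) :
    ℝ :=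
  |(game gen A true).toReal - 1 / 2|

/-- Negligible functions. -/
def Negligible (f : ℕ → ℝ) : Prop :=
  ∀ c : ℝ, 0 < c → ∃ n₀ : ℕ, 1 ≤ n₀ ∧ ∀ n : ℕ, n₀ ≤ n → |f n| ≤ (n : ℝ) ^ (-c)

/-- Weighted sum aggregator obliviousness: no family of adversaries, whatever its running time, has
more than a negligible advantage. In particular, no probabilistic polynomial-time one has. -/
def AggregatorOblivious (D : System) (gen : ℕ → PMF PaillierKey) (lam : ℕ → ℕ) : Prop :=
  ∀ A : ∀ κ, Adversary D (lam κ), Negligible fun κ => advantage (gen κ) (A κ)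

end PackedWSA

open PackedWSA

namespace PackedWSA

/-! ## Paillier encryption as a homomorphism -/

/-! Correctness. Paillier encryption is a homomorphism, so each block of an agent's ciphertext is
one encryption of packed slots `W̃x̃ + s + 2^γ z` (`enc_initW`). The width δ is large enough for the
sum over all agents to fit in a slot (`slot_total_lt`), so nothing spills over and the plaintext
stays below `N`. Modulo 2^γ the offsets, the noise and the shares all vanish, and the sum of the
`W̄x̄` is small enough to be read off from its signed residue (`slot_total_bmod`).

Obliviousness is statistical; Paillier contributes no secrecy. A run with bit `b` is reproduced
exactly with bit `!b` by changing the challenger's coins: at the challenge time, the share of each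
challenged agent moves by the difference of the two slot values modulo 2^γ, the noise `z` absorbs
the carry, and the Paillier randomness absorbs the change of unit (`enc_shiftCoins`). If the
aggregator is compromised, the moves must sum to zero. Either the equal aggregates ensure this, or
an uncorrupted agent outside the challenge takes up the difference (`exists_mask_shift`).

This change of coins is injective and works unless some noise lies near an end of its range, which
happens for at most a fraction 6·M·na/2^λ of the tapes. So, up to that fraction, each guess is
equally frequent under both bits. The bound holds for every key and all adversary coins, hence on
average. -/

theorem natCast_pow_eq_of_natCast_eq {N a b : ℕ} (h : (a : ZMod N) = b) :
    (a : ZMod (N ^ 2)) ^ N = (b : ZMod (N ^ 2)) ^ N := by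
  have h1 : (N : ℤ) ∣ (a : ℤ) - b := by
    rw [← ZMod.intCast_zmod_eq_zero_iff_dvd]
    push_cast
    rw [h, sub_self]
  -- The N-th power lifts a congruence modulo N to one modulo N². Hence r ↦ r^N mod N² is well
  -- defined and multiplicative on (ℤ/N)ˣ.
  have h2 := dvd_sub_pow_of_dvd_sub h1 1
  have h3 : ((N ^ 2 : ℕ) : ℤ) ∣ (a : ℤ) ^ N - (b : ℤ) ^ N := by simpa using h2
  rw [← ZMod.intCast_zmod_eq_zero_iff_dvd] at h3
  push_cast at h3
  exact sub_eq_zero.mp h3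

theorem encryptP_mul {N : ℕ} [NeZero N] (x y : ℕ) (r s : (ZMod N)ˣ) :
    encryptP N x r * encryptP N y s = encryptP N (x + y) (r * s) := by
  have h : (((r * s : (ZMod N)ˣ) : ZMod N).val : ZMod (N ^ 2)) ^ N =
      ((r : ZMod N).val : ZMod (N ^ 2)) ^ N * ((s : ZMod N).val : ZMod (N ^ 2)) ^ N := by
    rw [← mul_pow, ← Nat.cast_mul]
    apply natCast_pow_eq_of_natCast_eq
    simp
  unfold encryptP
  rw [h, pow_add]
  ring

theorem encryptP_zero_one (N : ℕ) [NeZero N] : encryptP N 0 1 = 1 := by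
  have h : (((1 : (ZMod N)ˣ) : ZMod N).val : ZMod (N ^ 2)) ^ N = ((1 : ℕ) : ZMod (N ^ 2)) ^ N := by
    apply natCast_pow_eq_of_natCast_eq
    simp
  unfold encryptP
  rw [h]
  simp

theorem encryptP_pow {N : ℕ} [NeZero N] (x : ℕ) (r : (ZMod N)ˣ) (k : ℕ) :
    encryptP N x r ^ k = encryptP N (x * k) (r ^ k) := by
  induction k with
  | zero => simp [encryptP_zero_one]
  | succ k ih => rw [pow_succ (encryptP N x r), ih, encryptP_mul, pow_succ r, mul_add_one]

theorem encryptP_prod {N : ℕ} [NeZero N] {ι : Type*} (s : Finset ι) (x : ι → ℕ)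
    (r : ι → (ZMod N)ˣ) :
    ∏ i ∈ s, encryptP N (x i) (r i) = encryptP N (∑ i ∈ s, x i) (∏ i ∈ s, r i) := by
  classical
  induction s using Finset.induction_on with
  | empty => simp [encryptP_zero_one]
  | insert a s ha ih =>
    rw [Finset.prod_insert ha, Finset.sum_insert ha, Finset.prod_insert ha, ih, encryptP_mul]

theorem one_add_natCast_pow (N m : ℕ) :
    (1 + (N : ZMod (N ^ 2))) ^ m = ((1 + m * N : ℕ) : ZMod (N ^ 2)) := by
  have h0 : (N : ZMod (N ^ 2)) * N = 0 := by
    rw [← pow_two, ← Nat.cast_pow, ZMod.natCast_self]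
  induction m with
  | zero => simp
  | succ m ih =>
    rw [pow_succ (1 + (N : ZMod (N ^ 2))) m, ih]
    push_cast
    linear_combination (m : ZMod (N ^ 2)) * h0

theorem decryptP_encryptP (K : PaillierKey) (x : ℕ) (r : (ZMod K.N)ˣ) :
    decryptP K.N (secretKey K) (encryptP K.N x r) = (x : ZMod K.N) := by
  have hN : 2 ≤ K.N := by
    have := Nat.mul_le_mul K.hp.two_le K.hq.one_le
    simpa [PaillierKey.N] using this
  set φ := Nat.totient K.N with hφ
  have hr : (((r : ZMod K.N).val : ZMod (K.N ^ 2)) ^ K.N) ^ φ = 1 := by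
    rw [← pow_mul, mul_comm, pow_mul, ← Nat.cast_pow,
      natCast_pow_eq_of_natCast_eq (b := 1), Nat.cast_one, one_pow]
    rw [Nat.cast_pow, ZMod.natCast_zmod_val, ← Units.val_pow_eq_pow_val, ZMod.pow_totient]
    simp
  -- The coefficient of N is reduced modulo N, so that the representative is literally below N² and
  -- the natural-number subtraction and division in `decryptP` are exact.
  have hc : encryptP K.N x r ^ φ = ((1 + (x * φ) % K.N * K.N : ℕ) : ZMod (K.N ^ 2)) := by
    unfold encryptP
    rw [mul_pow, hr, mul_one, ← pow_mul, one_add_natCast_pow, ZMod.natCast_eq_natCast_iff]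
    refine Nat.ModEq.add_left 1 ?_
    rw [pow_two]
    exact (Nat.ModEq.mul_right' K.N (Nat.mod_modEq _ _)).symm
  have hlt : 1 + (x * φ) % K.N * K.N < K.N ^ 2 := by
    have h1 : (x * φ) % K.N + 1 ≤ K.N := Nat.mod_lt _ (by omega)
    nlinarith
  unfold decryptP secretKey
  simp only
  rw [← hφ, hc, ZMod.val_natCast_of_lt hlt, Nat.add_sub_cancel_left,
    Nat.mul_div_cancel _ (by omega), ZMod.natCast_mod, Nat.cast_mul, mul_assoc,
    ZMod.coe_mul_inv_eq_one (n := K.N) φ K.coprime, mul_one]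

/-! ## Packing -/

theorem sum_digits_lt {B : ℕ} {f : ℕ → ℕ} (hf : ∀ j, f j < B) (m : ℕ) :
    ∑ j ∈ Finset.range m, f j * B ^ j < B ^ m := by
  induction m with
  | zero => simp
  | succ m ih =>
    rw [Finset.sum_range_succ, pow_succ]
    have := Nat.mul_le_mul_right (B ^ m) (Nat.succ_le_of_lt (hf m))
    rw [Nat.succ_mul] at this
    rw [mul_comm (B ^ m)]
    omega

theorem sum_digits_div_mod {B : ℕ} : ∀ {m i : ℕ} {f : ℕ → ℕ}, (∀ j, f j < B) → i < m →
    (∑ j ∈ Finset.range m, f j * B ^ j) / B ^ i % B = f i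
  | 0, _, _, _, hi => absurd hi (Nat.not_lt_zero _)
  | m + 1, i, f, hf, hi => by
    have hB : 0 < B := lt_of_le_of_lt (Nat.zero_le _) (hf 0)
    have h : ∑ j ∈ Finset.range (m + 1), f j * B ^ j =
        f 0 + B * ∑ j ∈ Finset.range m, f (j + 1) * B ^ j := by
      rw [Finset.sum_range_succ', Finset.mul_sum, add_comm]
      congr 1
      · simp
      · exact Finset.sum_congr rfl fun j _ => by ring
    rw [h]
    cases i with
    | zero => rw [pow_zero, Nat.div_one, Nat.add_mul_mod_self_left, Nat.mod_eq_of_lt (hf 0)]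
    | succ i =>
      rw [pow_succ', ← Nat.div_div_eq_div_mul, Nat.add_mul_div_left _ _ hB,
        Nat.div_eq_of_lt (hf 0), zero_add]
      exact sum_digits_div_mod (fun j => hf (j + 1)) (Nat.lt_of_succ_lt_succ hi)

section Packing

variable {D : System} {lam N : ℕ}

theorem pack_add (y z : Fin D.na → ℕ) (β : Fin (blocks D lam N)) :
    pack D lam N (fun k => y k + z k) β = pack D lam N y β + pack D lam N z β := by
  unfold pack
  rw [← Finset.sum_add_distrib]
  refine Finset.sum_congr rfl fun k _ => ?_
  split_ifs
  · rw [add_mul]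
  · rfl

theorem pack_mul (y : Fin D.na → ℕ) (a : ℕ) (β : Fin (blocks D lam N)) :
    pack D lam N (fun k => y k * a) β = pack D lam N y β * a := by
  unfold pack
  rw [Finset.sum_mul]
  refine Finset.sum_congr rfl fun k _ => ?_
  split_ifs
  · ring
  · simp

theorem pack_sum {ι : Type*} (s : Finset ι) (y : ι → Fin D.na → ℕ)
    (β : Fin (blocks D lam N)) :
    pack D lam N (fun k => ∑ i ∈ s, y i k) β = ∑ i ∈ s, pack D lam N (y i) β := by
  classical
  induction s using Finset.induction_on with
  | empty => simp [pack]
  | insert a s ha ih =>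
    simp only [Finset.sum_insert ha]
    rw [pack_add, ih]

theorem capacity_pos : 0 < capacity D lam N := lt_of_lt_of_le Nat.one_pos (le_max_left _ _)

/-- The content of slot `j` of block `β`. -/
def slotContent (lam N : ℕ) (y : Fin D.na → ℕ) (β : Fin (blocks D lam N)) (j : ℕ) : ℕ :=
  ∑ k : Fin D.na, if blockOf D lam N k = β ∧ slotOf D lam N k = j then y k else 0

/-- Regrouping the entries by slot turns a plaintext into an expansion in base 2^δ, to which the
digit lemmas apply. -/
theorem pack_eq_sum_slotContent (y : Fin D.na → ℕ) (β : Fin (blocks D lam N)) :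
    pack D lam N y β = ∑ j ∈ Finset.range (capacity D lam N),
      slotContent lam N y β j * (2 ^ D.del lam) ^ j := by
  unfold pack slotContent
  simp_rw [Finset.sum_mul]
  rw [Finset.sum_comm]
  refine Finset.sum_congr rfl fun k _ => ?_
  have hk : slotOf D lam N k ∈ Finset.range (capacity D lam N) :=
    Finset.mem_range.mpr (Nat.mod_lt _ capacity_pos)
  rw [Finset.sum_eq_single_of_mem _ hk]
  · by_cases h : blockOf D lam N k = β
    · simp [h, ← pow_mul, mul_comm]
    · simp [h]
  · intro j _ hj
    rw [if_neg fun h => hj h.2.symm, zero_mul]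

theorem slotContent_self (y : Fin D.na → ℕ) (k : Fin D.na) :
    slotContent lam N y (blockOf D lam N k) (slotOf D lam N k) = y k := by
  unfold slotContent
  rw [Finset.sum_eq_single k]
  · simp
  · intro k' _ hk'
    rw [if_neg]
    rintro ⟨h1, h2⟩
    apply hk'
    have h1' : k'.1 / capacity D lam N = k.1 / capacity D lam N := congrArg Fin.val h1
    have h2' : k'.1 % capacity D lam N = k.1 % capacity D lam N := h2
    rw [Fin.ext_iff, ← Nat.div_add_mod k'.1 (capacity D lam N), h1', h2', Nat.div_add_mod]
  · simp

theorem slotContent_lt {y : Fin D.na → ℕ} {B : ℕ} (hB : 0 < B) (hy : ∀ k, y k < B)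
    (β : Fin (blocks D lam N)) (j : ℕ) : slotContent lam N y β j < B := by
  by_cases h : ∃ k, blockOf D lam N k = β ∧ slotOf D lam N k = j
  · obtain ⟨k, rfl, rfl⟩ := h
    rw [slotContent_self]
    exact hy k
  · push Not at h
    unfold slotContent
    rw [Finset.sum_eq_zero]
    -- A slot without an entry, as at the end of the last block, has content 0.
    · exact hB
    · intro k _
      rw [if_neg fun hk => h k hk.1 hk.2]

theorem unpack_pack {y : Fin D.na → ℕ} (hy : ∀ k, y k < 2 ^ D.del lam) (k : Fin D.na) :
    unpack D lam N (pack D lam N y) k = y k := by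
  unfold unpack
  rw [pack_eq_sum_slotContent, mul_comm (slotOf D lam N k), pow_mul, sum_digits_div_mod]
  · exact slotContent_self y k
  · exact slotContent_lt (by positivity) hy _
  · exact Nat.mod_lt _ capacity_pos

theorem pack_lt {y : Fin D.na → ℕ} (hN : N ≠ 0) (hdel : D.del lam ≤ Nat.log 2 N)
    (hy : ∀ k, y k < 2 ^ D.del lam) (β : Fin (blocks D lam N)) : pack D lam N y β < N := by
  rw [pack_eq_sum_slotContent]
  refine (sum_digits_lt (slotContent_lt (by positivity) hy β) _).trans_le ?_
  have hcap : D.del lam * capacity D lam N ≤ Nat.log 2 N := by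
    have hd : 0 < D.del lam := by unfold System.del; omega
    have : capacity D lam N = Nat.log 2 N / D.del lam :=
      max_eq_right ((Nat.one_le_div_iff hd).mpr hdel)
    rw [this]
    exact Nat.mul_div_le _ _
  rw [← pow_mul]
  exact (Nat.pow_le_pow_right two_pos hcap).trans (Nat.pow_log_le_self 2 hN)

/-! ## Ciphertexts of the scheme -/

/-- The contribution `∑ W̃ x̃` of the offset data to each slot. -/
def offsetProduct {i : Fin D.M} (W : D.Weights i) (x : D.Data i) (k : Fin D.na) : ℕ :=
  ∑ c, System.tilde (W k c) * System.tilde (x c)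

/-- The normal form on which both correctness and obliviousness rest: a single encryption with
explicit plaintext and randomness. -/
theorem enc_initW [NeZero N] {i : Fin D.M} (W : D.Weights i) (rI : InitCoins D lam N i)
    (sk : Shares D) (t : Fin D.T) (x : D.Data i) (r : EncCoins D lam N i)
    (β : Fin (blocks D lam N)) :
    enc lam N (initW lam N W rI) sk t x r β =
      encryptP N (pack D lam N (fun k => offsetProduct W x k +
          ((sk t k).val + 2 ^ D.gam * (r.1 k).val)) β)
        ((∏ c, rI c β ^ System.tilde (x c)) * r.2 β) := by
  have h : pack D lam N (fun k => offsetProduct W x k) β =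
      ∑ c, pack D lam N (fun k => System.tilde (W k c)) β * System.tilde (x c) := by
    unfold offsetProduct
    rw [pack_sum]
    exact Finset.sum_congr rfl fun c _ => pack_mul _ _ _
  rw [pack_add, h, ← encryptP_mul, ← encryptP_prod]
  unfold enc initW
  simp_rw [encryptP_pow]

end Packing

/-! ## Fixed-point data -/

section FixedPoint

variable {D : System}

theorem bar_spec (y : D.FixedPt) :
    -2 ^ D.l ≤ 2 * System.bar y ∧ 2 * System.bar y < 2 ^ D.l ∧
      (System.bar y : ℚ) = y.1 * 2 ^ D.lf := by
  obtain ⟨a, h1, h2, h3⟩ := y.2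
  have : System.bar y = a := by
    unfold System.bar
    rw [h3, Int.floor_intCast]
  rw [this]
  exact ⟨h1, h2, h3.symm⟩

theorem l_lt_gam (D : System) : 2 * D.l + 1 ≤ D.gam := by
  unfold System.gam
  omega

theorem tilde_eq (y : D.FixedPt) : (System.tilde y : ℤ) = System.bar y + 2 ^ D.gam := by
  obtain ⟨h1, -, -⟩ := bar_spec y
  have h2 : (2 : ℤ) ^ D.l ≤ 2 ^ D.gam :=
    pow_le_pow_right₀ (by norm_num) (by have := l_lt_gam D; omega)
  have h3 : (0 : ℤ) < 2 ^ D.l := by positivity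
  unfold System.tilde
  rw [Int.toNat_of_nonneg]
  omega

theorem tilde_lt (y : D.FixedPt) : System.tilde y < 2 ^ (D.gam + 1) := by
  obtain ⟨-, h1, -⟩ := bar_spec y
  have h2 : (2 : ℤ) ^ D.l ≤ 2 ^ D.gam :=
    pow_le_pow_right₀ (by norm_num) (by have := l_lt_gam D; omega)
  have h3 : (0 : ℤ) < 2 ^ D.l := by positivity
  zify
  rw [tilde_eq, pow_succ]
  omega

theorem tilde_cast (y : D.FixedPt) : (System.tilde y : ZMod (2 ^ D.gam)) = System.bar y := by
  have h := congrArg (Int.cast : ℤ → ZMod (2 ^ D.gam)) (tilde_eq y)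
  have h0 : (2 : ZMod (2 ^ D.gam)) ^ D.gam = 0 := by
    have := ZMod.natCast_self (2 ^ D.gam)
    push_cast at this
    exact this
  push_cast at h
  rw [h, h0, add_zero]

/-- The exact product of the integers `W̄` and `x̄`. -/
def barProduct {i : Fin D.M} (W : D.Weights i) (x : D.Data i) (k : Fin D.na) : ℤ :=
  ∑ c, System.bar (W k c) * System.bar (x c)

theorem offsetProduct_cast {i : Fin D.M} (W : D.Weights i) (x : D.Data i) (k : Fin D.na) :
    (offsetProduct W x k : ZMod (2 ^ D.gam)) = barProduct W x k := by
  unfold offsetProduct barProduct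
  push_cast
  simp_rw [tilde_cast]

theorem barProduct_eq {i : Fin D.M} (W : D.Weights i) (x : D.Data i) (k : Fin D.na) :
    (barProduct W x k : ℚ) = System.apply W x k * 2 ^ (2 * D.lf) := by
  unfold barProduct System.apply Matrix.mulVec dotProduct
  push_cast
  rw [Finset.sum_mul]
  refine Finset.sum_congr rfl fun c _ => ?_
  rw [(bar_spec (W k c)).2.2, (bar_spec (x c)).2.2, Matrix.map_apply]
  ring

theorem abs_barProduct_le {i : Fin D.M} (W : D.Weights i) (x : D.Data i) (k : Fin D.na) :
    4 * |barProduct W x k| ≤ D.n i * 2 ^ (2 * D.l) := by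
  have hb : ∀ y : D.FixedPt, |2 * System.bar y| ≤ 2 ^ D.l := fun y =>
    abs_le.mpr ⟨(bar_spec y).1, (bar_spec y).2.1.le⟩
  have h4 : 4 * |barProduct W x k| = |∑ c, (2 * System.bar (W k c)) * (2 * System.bar (x c))| := by
    rw [show (4 : ℤ) = |4| from rfl, ← abs_mul, barProduct, Finset.mul_sum]
    exact congrArg _ (Finset.sum_congr rfl fun c _ => by ring)
  rw [h4]
  refine (Finset.abs_sum_le_sum_abs _ _).trans ?_
  refine (Finset.sum_le_card_nsmul _ _ (2 ^ (2 * D.l)) fun c _ => ?_).trans (by simp)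
  rw [abs_mul, two_mul D.l, pow_add]
  exact mul_le_mul (hb _) (hb _) (abs_nonneg _) (by positivity)

theorem offsetProduct_le {i : Fin D.M} (W : D.Weights i) (x : D.Data i) (k : Fin D.na) :
    offsetProduct W x k ≤ D.n i * 2 ^ (2 * (D.gam + 1)) := by
  refine (Finset.sum_le_card_nsmul _ _ (2 ^ (2 * (D.gam + 1))) fun c _ => ?_).trans (by simp)
  rw [two_mul (D.gam + 1), pow_add]
  exact Nat.mul_le_mul (tilde_lt _).le (tilde_lt _).le

theorem n_le (D : System) (i : Fin D.M) : D.n i ≤ 2 ^ Nat.clog 2 D.nMax :=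
  (Finset.le_sup (f := D.n) (Finset.mem_univ i)).trans (Nat.le_pow_clog one_lt_two _)

end FixedPoint

/-! ## Correctness -/

/-- The offset products, the masks with their noise, and the share of the aggregator each contribute
at most 2^(δ-2). -/
theorem slot_total_lt {D : System} {lam : ℕ} (W : ∀ i, D.Weights i) (x : ∀ i, D.Data i)
    (s : Fin D.M → ZMod (2 ^ D.gam)) (sa : ZMod (2 ^ D.gam))
    (z : ∀ i, Fin (2 ^ D.noiseBits lam i)) (k : Fin D.na) :
    ∑ i, (offsetProduct (W i) (x i) k + ((s i).val + 2 ^ D.gam * (z i).val)) + sa.val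
      < 2 ^ D.del lam := by
  have hM : D.M ≤ 2 ^ Nat.clog 2 D.M := Nat.le_pow_clog one_lt_two _
  have h1 : ∀ i, offsetProduct (W i) (x i) k ≤
      2 ^ (Nat.clog 2 D.nMax + 2 * (D.gam + 1)) := fun i => by
    rw [pow_add]
    exact (offsetProduct_le _ _ _).trans (Nat.mul_le_mul_right _ (n_le D i))
  have h2 : ∀ i, (s i).val + 2 ^ D.gam * (z i).val ≤
      2 ^ (D.gam + (D.l + 1 + lam + Nat.clog 2 D.nMax)) := fun i => by
    have h3 := ZMod.val_lt (s i)
    have h4 : 2 ^ D.gam * ((z i).val + 1) ≤ 2 ^ D.gam * 2 ^ D.noiseBits lam i :=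
      Nat.mul_le_mul_left _ (z i).2
    have h5 : 2 ^ (D.gam + D.noiseBits lam i) ≤
        2 ^ (D.gam + (D.l + 1 + lam + Nat.clog 2 D.nMax)) := by
      refine Nat.pow_le_pow_right two_pos ?_
      have : Nat.clog 2 (D.n i) ≤ Nat.clog 2 D.nMax :=
        Nat.clog_mono_right 2 (Finset.le_sup (f := D.n) (Finset.mem_univ i))
      unfold System.noiseBits
      omega
    rw [pow_add] at h5
    rw [mul_add_one] at h4
    omega
  have h6 : ∑ i, (offsetProduct (W i) (x i) k + ((s i).val + 2 ^ D.gam * (z i).val)) ≤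
      2 ^ Nat.clog 2 D.M * (2 ^ (Nat.clog 2 D.nMax + 2 * (D.gam + 1)) +
        2 ^ (D.gam + (D.l + 1 + lam + Nat.clog 2 D.nMax))) := by
    refine (Finset.sum_le_card_nsmul _ _ _ fun i _ => add_le_add (h1 i) (h2 i)).trans ?_
    rw [smul_eq_mul, Finset.card_univ, Fintype.card_fin]
    exact Nat.mul_le_mul_right _ hM
  rw [mul_add, ← pow_add, ← pow_add] at h6
  obtain ⟨e, he⟩ : ∃ e, D.del lam = e + 2 := ⟨D.del lam - 2, by unfold System.del; omega⟩
  have hmax := le_max_left (D.l + 2 + Nat.clog 2 D.nMax + Nat.clog 2 D.M) lam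
  have hmax' := le_max_right (D.l + 2 + Nat.clog 2 D.nMax + Nat.clog 2 D.M) lam
  have hle : ∀ a, a + 2 ≤ D.del lam → 2 ^ a ≤ 2 ^ e := fun a ha =>
    Nat.pow_le_pow_right two_pos (by omega)
  -- The two arguments of the maximum in δ are exactly what this bound and the next one require.
  have e1 := hle (Nat.clog 2 D.M + (Nat.clog 2 D.nMax + 2 * (D.gam + 1)))
    (by unfold System.del System.gam; omega)
  have e2 := hle (Nat.clog 2 D.M + (D.gam + (D.l + 1 + lam + Nat.clog 2 D.nMax)))
    (by unfold System.del System.gam; omega)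
  have e3 := hle D.gam (by unfold System.del System.gam; omega)
  have h7 := ZMod.val_lt sa
  rw [he, pow_add]
  omega

/-- The shares cancel modulo 2^γ, and the exact sum has absolute value at most 2^(γ-3), well inside
the window of signed residues. -/
theorem slot_total_bmod {D : System} {lam : ℕ} (W : ∀ i, D.Weights i) (x : ∀ i, D.Data i)
    (s : Fin D.M → ZMod (2 ^ D.gam)) (z : ∀ i, Fin (2 ^ D.noiseBits lam i)) (k : Fin D.na) :
    Int.bmod ((∑ i, (offsetProduct (W i) (x i) k + ((s i).val + 2 ^ D.gam * (z i).val)) +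
      (-∑ i, s i).val : ℕ) : ℤ) (2 ^ D.gam) = ∑ i, barProduct (W i) (x i) k := by
  have h0 : (2 : ZMod (2 ^ D.gam)) ^ D.gam = 0 := by
    have := ZMod.natCast_self (2 ^ D.gam)
    push_cast at this
    exact this
  have hmod : (∑ i, (offsetProduct (W i) (x i) k + ((s i).val + 2 ^ D.gam * (z i).val)) +
      (-∑ i, s i).val : ℕ) ≡ ∑ i, barProduct (W i) (x i) k [ZMOD ((2 ^ D.gam : ℕ) : ℤ)] := by
    rw [← ZMod.intCast_eq_intCast_iff, Int.cast_natCast, Nat.cast_add, Nat.cast_sum, Int.cast_sum]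
    simp only [Nat.cast_add, Nat.cast_mul, Nat.cast_pow, Nat.cast_ofNat, h0, zero_mul, add_zero,
      ZMod.natCast_zmod_val, offsetProduct_cast, Finset.sum_add_distrib]
    abel
  rw [← Int.emod_bmod, hmod, Int.emod_bmod]
  have habs : 4 * |∑ i, barProduct (W i) (x i) k| ≤
      2 ^ (Nat.clog 2 D.M + (Nat.clog 2 D.nMax + 2 * D.l)) := by
    calc 4 * |∑ i, barProduct (W i) (x i) k| ≤ ∑ i, 4 * |barProduct (W i) (x i) k| := by
          rw [← Finset.mul_sum]
          exact mul_le_mul_of_nonneg_left (Finset.abs_sum_le_sum_abs _ _) (by norm_num)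
      _ ≤ ∑ _i : Fin D.M, 2 ^ (Nat.clog 2 D.nMax + 2 * D.l) := by
          refine Finset.sum_le_sum fun i _ => (abs_barProduct_le _ _ _).trans ?_
          rw [pow_add]
          exact mul_le_mul_of_nonneg_right (by exact_mod_cast n_le D i) (by positivity)
      _ ≤ _ := by
          rw [Finset.sum_const, Finset.card_univ, Fintype.card_fin, nsmul_eq_mul,
            pow_add _ (Nat.clog 2 D.M)]
          exact mul_le_mul_of_nonneg_right
            (by exact_mod_cast Nat.le_pow_clog one_lt_two D.M) (by positivity)
  have hpow : (2 : ℤ) ^ D.gam = 2 * 2 ^ (Nat.clog 2 D.M + (Nat.clog 2 D.nMax + 2 * D.l)) := by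
    rw [← pow_succ']
    congr 1
    unfold System.gam
    omega
  have hpos : (0 : ℤ) < 2 ^ (Nat.clog 2 D.M + (Nat.clog 2 D.nMax + 2 * D.l)) := by positivity
  have h1 := neg_abs_le (∑ i, barProduct (W i) (x i) k)
  have h2 := le_abs_self (∑ i, barProduct (W i) (x i) k)
  apply Int.bmod_eq_of_le_mul_two
  · push_cast
    rw [hpow]
    linarith
  · push_cast
    rw [hpow]
    linarith

theorem isCorrect (D : System) (gen : ℕ → PMF PaillierKey) (lam : ℕ → ℕ) :
    IsCorrect D gen lam := by
  intro κ K _ hdel s W rW t x r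
  have hN : K.N ≠ 0 := NeZero.ne _
  set Y : Fin D.na → ℕ := fun k => ∑ i, (offsetProduct (W i) (x i) k +
    ((s i t k).val + 2 ^ D.gam * ((r i).1 k).val)) with hY
  have hlt : ∀ k, Y k + (aggShares s t k).val < 2 ^ D.del (lam κ) := fun k =>
    slot_total_lt W x (fun i => s i t k) (aggShares s t k) (fun i => (r i).1 k) k
  have hP : (fun β => (decryptP K.N (secretKey K)
      (∏ i, enc (lam κ) K.N (initW (lam κ) K.N (W i) (rW i)) (s i) t (x i) (r i) β)).val +
        pack D (lam κ) K.N (fun k' => (aggShares s t k').val) β) =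
      pack D (lam κ) K.N (fun k => Y k + (aggShares s t k).val) := by
    funext β
    simp_rw [enc_initW, encryptP_prod, ← pack_sum]
    rw [decryptP_encryptP, ZMod.val_natCast_of_lt, pack_add]
    exact pack_lt hN hdel (fun k => (Nat.le_add_right _ _).trans_lt (hlt k)) β
  funext k
  unfold aggrDec
  simp only
  rw [hP, unpack_pack hlt, hY]
  have hb := slot_total_bmod W x (fun i => s i t k) (fun i => (r i).1 k) k
  have hs : aggShares s t k = -∑ i, s i t k := rfl
  rw [hs, hb, div_eq_iff (by positivity), Finset.sum_apply, Finset.sum_mul]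
  push_cast
  exact Finset.sum_congr rfl fun i _ => barProduct_eq _ _ _

/-! ## Re-randomizing the tape -/

section Shift

variable {D : System}

/-- Cyclic translation of `Fin m` by an integer. -/
def finShift {m : ℕ} (z : Fin m) (c : ℤ) : Fin m :=
  ⟨((z.val + c) % m).toNat, by
    have hm : (0 : ℤ) < m := by exact_mod_cast z.pos
    have h1 := Int.emod_nonneg (z.val + c) hm.ne'
    have h2 := Int.emod_lt_of_pos (z.val + c) hm
    omega⟩

theorem finShift_val {m : ℕ} {z : Fin m} {c : ℤ} (h0 : 0 ≤ z.val + c) (h1 : z.val + c < m) :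
    ((finShift z c).val : ℤ) = z.val + c := by
  have h : (finShift z c).val = ((z.val + c) % m).toNat := rfl
  rw [h, Int.emod_eq_of_lt h0 h1, Int.toNat_of_nonneg h0]

/-- Wrapping around keeps the translation injective on the whole range. It agrees with integer
addition only away from the ends, whence the margin condition below. -/
theorem finShift_injective {m : ℕ} (c : ℤ) :
    Function.Injective fun z : Fin m => finShift z c := by
  intro z z' h
  have hm : (0 : ℤ) < m := by exact_mod_cast z.pos
  have h1 := Int.emod_nonneg (z.val + c) hm.ne'
  have h2 := Int.emod_nonneg (z'.val + c) hm.ne'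
  have h3 : ((z.val + c) % m).toNat = ((z'.val + c) % m).toNat := congrArg Fin.val h
  have h4 : (z.val : ℤ) + c ≡ z'.val + c [ZMOD m] := by
    unfold Int.ModEq
    omega
  have h5 := Int.ModEq.add_right_cancel' c h4
  have h6 : z.val ≡ z'.val [MOD m] := Int.natCast_modEq_iff.mp h5
  exact Fin.ext (h6.eq_of_lt_of_lt z.2 z'.2)

/-- The multiple of `2 ^ γ` that the noise has to absorb when `s + d` replaces the mask `s` and `a'`
replaces the value `a`. -/
def carry (s d : ZMod (2 ^ D.gam)) (a a' : ℕ) : ℤ :=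
  (s.val + a - a' - (s + d).val) / 2 ^ D.gam

theorem carry_mul {s d : ZMod (2 ^ D.gam)} {a a' : ℕ} (hd : d = a - a') :
    carry s d a a' * 2 ^ D.gam = s.val + a - a' - (s + d).val := by
  unfold carry
  refine Int.ediv_mul_cancel ?_
  have h : ((2 ^ D.gam : ℕ) : ℤ) ∣ s.val + a - a' - (s + d).val := by
    rw [← ZMod.intCast_zmod_eq_zero_iff_dvd]
    push_cast
    rw [ZMod.natCast_zmod_val, ZMod.natCast_zmod_val, hd]
    ring
  simpa using h

/-- A bound for the change of the noise of agent `i`. -/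
def noiseMargin (D : System) (i : Fin D.M) : ℕ := 3 * 2 ^ (D.l + 1 + Nat.clog 2 (D.n i))

/-- Isolates the dominant term n·2^(2γ), which does not depend on the data and so cancels between
the two challenge series. This keeps the carry small. -/
theorem offsetProduct_eq {i : Fin D.M} (W : D.Weights i) (x : D.Data i) (k : Fin D.na) :
    (offsetProduct W x k : ℤ) = D.n i * (2 ^ D.gam * 2 ^ D.gam) +
      2 ^ D.gam * ∑ c, (System.bar (W k c) + System.bar (x c)) + barProduct W x k := by
  unfold offsetProduct barProduct
  push_cast
  simp_rw [tilde_eq]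
  have h : (D.n i : ℤ) * (2 ^ D.gam * 2 ^ D.gam) =
      ∑ _c : Fin (D.n i), (2 : ℤ) ^ D.gam * 2 ^ D.gam := by simp
  rw [h, Finset.mul_sum, ← Finset.sum_add_distrib, ← Finset.sum_add_distrib]
  exact Finset.sum_congr rfl fun c _ => by ring

theorem abs_sum_bar_le {i : Fin D.M} (W : D.Weights i) (x : D.Data i) (k : Fin D.na) :
    |∑ c, (System.bar (W k c) + System.bar (x c))| ≤ D.n i * 2 ^ D.l := by
  refine (Finset.abs_sum_le_sum_abs _ _).trans ?_
  refine (Finset.sum_le_card_nsmul _ _ (2 ^ D.l) fun c _ => ?_).trans (by simp)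
  obtain ⟨h1, h2, -⟩ := bar_spec (W k c)
  obtain ⟨h3, h4, -⟩ := bar_spec (x c)
  rw [abs_le]
  constructor <;> linarith

theorem abs_carry_le {i : Fin D.M} (W W' : D.Weights i) (x x' : D.Data i) (k : Fin D.na)
    {s d : ZMod (2 ^ D.gam)} (hd : d = offsetProduct W x k - offsetProduct W' x' k) :
    |carry s d (offsetProduct W x k) (offsetProduct W' x' k)| ≤ noiseMargin D i := by
  have hc := carry_mul (s := s) hd
  rw [offsetProduct_eq, offsetProduct_eq] at hc
  set C := carry s d (offsetProduct W x k) (offsetProduct W' x' k)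
  have hG : (0 : ℤ) < 2 ^ D.gam := by positivity
  have h1 : ((ZMod.val s : ℕ) : ℤ) < 2 ^ D.gam := by exact_mod_cast ZMod.val_lt s
  have h2 : ((ZMod.val (s + d) : ℕ) : ℤ) < 2 ^ D.gam := by exact_mod_cast ZMod.val_lt (s + d)
  have h3 := abs_le.mp (abs_sum_bar_le W x k)
  have h4 := abs_le.mp (abs_sum_bar_le W' x' k)
  have hbar : ∀ (V : D.Weights i) (y : D.Data i), |barProduct V y k| * 4 ≤ 2 ^ D.gam := by
    intro V y
    rw [mul_comm]
    refine (abs_barProduct_le V y k).trans ?_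
    have h : (D.n i : ℤ) ≤ 2 ^ Nat.clog 2 D.nMax := by exact_mod_cast n_le D i
    refine (mul_le_mul_of_nonneg_right h (by positivity)).trans ?_
    rw [← pow_add]
    exact pow_le_pow_right₀ (by norm_num) (by unfold System.gam; omega)
  have h5 := hbar W x
  have h6 := hbar W' x'
  have h7 := abs_le.mp (le_refl |barProduct W x k|)
  have h8 := abs_le.mp (le_refl |barProduct W' x' k|)
  set P := ∑ c, (System.bar (W k c) + System.bar (x c))
  set P' := ∑ c, (System.bar (W' k c) + System.bar (x' c))
  -- The carry is P - P', of size at most 2·n·2^l, plus a correction. The right side is below 2·2^γ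
  -- in absolute value, so the correction lies strictly between -2 and 2.
  have h9 : (C - (P - P')) * 2 ^ D.gam = s.val - (s + d).val + barProduct W x k -
      barProduct W' x' k := by linear_combination hc
  have h10 : C - (P - P') < 2 := by
    refine lt_of_mul_lt_mul_right ?_ hG.le
    rw [h9]
    have := (s + d).val.cast_nonneg (α := ℤ)
    linarith
  have h11 : -2 < C - (P - P') := by
    refine lt_of_mul_lt_mul_right ?_ hG.le
    rw [h9]
    have := s.val.cast_nonneg (α := ℤ)
    linarith
  have h12 : (D.n i : ℤ) * 2 ^ D.l ≤ 2 ^ (D.l + Nat.clog 2 (D.n i)) := by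
    rw [add_comm, pow_add]
    exact mul_le_mul_of_nonneg_right (by exact_mod_cast Nat.le_pow_clog one_lt_two (D.n i))
      (by positivity)
  have h13 : (0 : ℤ) < 2 ^ (D.l + Nat.clog 2 (D.n i)) := by positivity
  have h14 : (noiseMargin D i : ℤ) = 6 * 2 ^ (D.l + Nat.clog 2 (D.n i)) := by
    unfold noiseMargin
    push_cast
    ring
  rw [h14, abs_le]
  constructor <;> linarith

variable {lam N : ℕ}

/-- The change of Paillier randomness that compensates for a change of the local data. -/
def unitShift {i : Fin D.M} (rI : InitCoins D lam N i) (x x' : D.Data i)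
    (β : Fin (blocks D lam N)) : (ZMod N)ˣ :=
  (∏ c, rI c β ^ System.tilde (x c)) / ∏ c, rI c β ^ System.tilde (x' c)

/-- Coins of agent `i` with which the data `W'`, `x'` give the ciphertext of `W`, `x` when the masks
`s` are changed to `s + d`. -/
def shiftCoins {i : Fin D.M} (W W' : D.Weights i) (x x' : D.Data i)
    (s d : Fin D.na → ZMod (2 ^ D.gam)) (r : InitCoins D lam N i × EncCoins D lam N i) :
    InitCoins D lam N i × EncCoins D lam N i :=
  (r.1, fun k => finShift (r.2.1 k)
      (carry (s k) (d k) (offsetProduct W x k) (offsetProduct W' x' k)),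
    fun β => unitShift r.1 x x' β * r.2.2 β)

/-- The two translations depend only on `s`, `d`, the data and the `InitW` coins, all of which stay
fixed. -/
theorem shiftCoins_injective {i : Fin D.M} (W W' : D.Weights i) (x x' : D.Data i)
    (s d : Fin D.na → ZMod (2 ^ D.gam)) :
    Function.Injective (shiftCoins (lam := lam) (N := N) W W' x x' s d) := by
  rintro ⟨a, b, c⟩ ⟨a', b', c'⟩ h
  simp only [shiftCoins, Prod.mk.injEq] at h
  obtain ⟨rfl, h2, h3⟩ := h
  have h4 : b = b' := funext fun k => finShift_injective _ (congrFun h2 k)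
  have h5 : c = c' := funext fun β => mul_left_cancel (congrFun h3 β)
  rw [h4, h5]

/-- The slot values agree as integers, not only modulo 2^γ, and the randomness agrees too. The
ciphertexts are therefore identical, and even the Paillier secret key cannot tell them apart. -/
theorem enc_shiftCoins [NeZero N] {i : Fin D.M} (W W' : D.Weights i) (x x' : D.Data i)
    (sk sk' : Shares D) (t : Fin D.T) (d : Fin D.na → ZMod (2 ^ D.gam))
    (r : InitCoins D lam N i × EncCoins D lam N i)
    (hsk : ∀ k, sk' t k = sk t k + d k)
    (hd : ∀ k, d k = offsetProduct W x k - offsetProduct W' x' k)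
    (hr : ∀ k, noiseMargin D i ≤ (r.2.1 k).val ∧
      (r.2.1 k).val + noiseMargin D i < 2 ^ D.noiseBits lam i) :
    enc lam N (initW lam N W' (shiftCoins W W' x x' (sk t) d r).1) sk' t x'
        (shiftCoins W W' x x' (sk t) d r).2 =
      enc lam N (initW lam N W r.1) sk t x r.2 := by
  funext β
  rw [enc_initW, enc_initW]
  refine congrArg₂ (encryptP N) (congrArg (fun y => pack D lam N y β) ?_) ?_
  · funext k
    have h1 := abs_le.mp (abs_carry_le W W' x x' k (s := sk t k) (hd k))
    obtain ⟨h2, h3⟩ := hr k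
    have h4 := carry_mul (s := sk t k) (hd k)
    have h5 := finShift_val (z := r.2.1 k)
      (c := carry (sk t k) (d k) (offsetProduct W x k) (offsetProduct W' x' k))
      (by linarith [(Nat.cast_le (α := ℤ)).mpr h2])
      (by linarith [(Nat.cast_lt (α := ℤ)).mpr h3, (Nat.cast_add (R := ℤ) (r.2.1 k).val
        (noiseMargin D i))])
    have h6 : (shiftCoins W W' x x' (sk t) d r).2.1 k = finShift (r.2.1 k)
      (carry (sk t k) (d k) (offsetProduct W x k) (offsetProduct W' x' k)) := rfl
    zify
    rw [h6, h5, hsk]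
    linear_combination h4
  · change (∏ c, r.1 c β ^ System.tilde (x' c)) * (unitShift r.1 x x' β * r.2.2 β) =
      (∏ c, r.1 c β ^ System.tilde (x c)) * r.2.2 β
    unfold unitShift
    rw [← mul_assoc, mul_div_cancel]

/-- The tape that explains, for the challenge bit `!b`, the answers given with the bit `b`. -/
def shiftTape (b : Bool) (ch : Challenge D) (d : Fin D.M → Fin D.na → ZMod (2 ^ D.gam))
    (tape : Tape D lam N) : Tape D lam N :=
  (fun i t k => if t = ch.t then tape.1 i t k + d i k else tape.1 i t k, tape.2.1,
    fun i => if some i ∈ ch.S then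
      shiftCoins (ch.W b i) (ch.W (!b) i) (ch.x b i) (ch.x (!b) i) (tape.1 i ch.t) (d i)
        (tape.2.2 i)
    else tape.2.2 i)

/-- The new challenge coins depend on the old shares, so the shares are recovered before those
coins. -/
theorem shiftTape_injective (b : Bool) (ch : Challenge D)
    (d : Fin D.M → Fin D.na → ZMod (2 ^ D.gam)) :
    Function.Injective (shiftTape (lam := lam) (N := N) b ch d) := by
  rintro ⟨s, e, r⟩ ⟨s', e', r'⟩ h
  simp only [shiftTape, Prod.mk.injEq] at h
  obtain ⟨h1, rfl, h3⟩ := h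
  have hs : s = s' := by
    funext i t k
    have := congrFun (congrFun (congrFun h1 i) t) k
    split_ifs at this
    · exact add_right_cancel this
    · exact this
  subst hs
  have hr : r = r' := by
    funext i
    have := congrFun h3 i
    split_ifs at this
    · exact shiftCoins_injective _ _ _ _ _ _ this
    · exact this
  rw [hr]

end Shift

/-! ## The game -/

section Game

variable {D : System} {lam : ℕ}

theorem mem_run_of_mem (A : Adversary D lam) (ω : A.Coins) (K : PaillierKey) (b : Bool)
    (tape : Tape D lam K.N) (k : ℕ) (h : History D lam K.N) {e : Query D × Answer D lam K.N}
    (he : e ∈ h) : e ∈ run A ω K b tape k h := by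
  induction k generalizing h with
  | zero => exact he
  | succ k ih =>
    unfold run
    split
    · exact he
    · exact ih _ (List.mem_append_left _ he)

/-- Only the answers to queries actually asked matter: as long as the views agree, so does the next
query. -/
theorem run_congr (A : Adversary D lam) (ω : A.Coins) (K : PaillierKey) {b b' : Bool}
    {tape tape' : Tape D lam K.N} (k : ℕ) (h : History D lam K.N)
    (heq : ∀ q ∈ (run A ω K b tape k h).map Prod.fst,
      answer lam K b' tape' q = answer lam K b tape q) :
    run A ω K b' tape' k h = run A ω K b tape k h := by
  induction k generalizing h with
  | zero => rfl
  | succ k ih =>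
    unfold run at heq ⊢
    cases hn : A.next ω K.N h with
    | none => rfl
    | some q =>
      simp only [hn] at heq ⊢
      have hq : answer lam K b' tape' q = answer lam K b tape q :=
        heq q (List.mem_map_of_mem (f := Prod.fst) (mem_run_of_mem A ω K b tape k _
          (List.mem_append_right h (List.mem_singleton_self _))))
      rw [hq]
      exact ih _ heq

/-- The noise of all agents in the challenge is far from the ends of its range. -/
def NoiseInMargin {N : ℕ} (tape : Tape D lam N) : Prop :=
  ∀ i k, noiseMargin D i ≤ ((tape.2.2 i).2.1 k).val ∧
    ((tape.2.2 i).2.1 k).val + noiseMargin D i < 2 ^ D.noiseBits lam i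

/-- The shift must explain the challenge, be invisible in corrupted agents, and leave the
aggregator's share unchanged if that share has been revealed. -/
theorem exists_mask_shift {qs : List (Query D)} {ch : Challenge D}
    (hS : (ch.S : Set (Option (Fin D.M))) ⊆ uncorrupted qs ch.t)
    (hsum : (ch.S : Set (Option (Fin D.M))) = uncorrupted qs ch.t → none ∉ ch.S →
      (∑ i with some i ∈ ch.S, System.apply (ch.W false i) (ch.x false i)) =
        ∑ i with some i ∈ ch.S, System.apply (ch.W true i) (ch.x true i)) (b : Bool) :
    ∃ d : Fin D.M → Fin D.na → ZMod (2 ^ D.gam),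
      (∀ i, some i ∈ ch.S → ∀ k, d i k = offsetProduct (ch.W b i) (ch.x b i) k -
        offsetProduct (ch.W (!b) i) (ch.x (!b) i) k) ∧
      (∀ i, some i ∉ uncorrupted qs ch.t → d i = 0) ∧
      (Query.compromise none ∈ qs → ∑ i, d i = 0) := by
  classical
  set e : Fin D.M → Fin D.na → ZMod (2 ^ D.gam) := fun i k => if some i ∈ ch.S then
    (offsetProduct (ch.W b i) (ch.x b i) k : ZMod (2 ^ D.gam)) -
      offsetProduct (ch.W (!b) i) (ch.x (!b) i) k else 0 with he
  have he0 : ∀ i, some i ∉ ch.S → e i = 0 := fun i hi => by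
    funext k
    simp [he, hi]
  by_cases hagg : Query.compromise none ∈ qs
  · have hU : none ∉ uncorrupted qs ch.t := fun h => h.1 hagg
    have hnone : none ∉ ch.S := fun h => hU (hS h)
    by_cases hSU : (ch.S : Set (Option (Fin D.M))) = uncorrupted qs ch.t
    · refine ⟨e, fun i hi k => by simp [he, hi], fun i hi => he0 i fun h => hi (hS h),
        fun _ => ?_⟩
      have hz : ∀ k, ∑ i with some i ∈ ch.S, barProduct (ch.W false i) (ch.x false i) k =
          ∑ i with some i ∈ ch.S, barProduct (ch.W true i) (ch.x true i) k := fun k => by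
        have h := congrFun (hsum hSU hnone) k
        rw [Finset.sum_apply, Finset.sum_apply] at h
        have h2 : ((∑ i with some i ∈ ch.S, barProduct (ch.W false i) (ch.x false i) k : ℤ) : ℚ) =
            (∑ i with some i ∈ ch.S, barProduct (ch.W true i) (ch.x true i) k : ℤ) := by
          push_cast
          simp_rw [barProduct_eq]
          rw [← Finset.sum_mul, h, Finset.sum_mul]
        exact_mod_cast h2
      funext k
      rw [Finset.sum_apply, Pi.zero_apply, he]
      simp only
      rw [← Finset.sum_filter, Finset.sum_sub_distrib]
      simp_rw [offsetProduct_cast, ← Int.cast_sum]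
      cases b
      · rw [hz]
        exact sub_self _
      · rw [← hz]
        exact sub_self _
    -- The spare participant is an agent because the aggregator is compromised. Its share at the
    -- challenge time is never used in an answer, so it can balance the sum.
    · obtain ⟨u, hu, hu'⟩ := Set.exists_of_ssubset (hS.ssubset_of_ne hSU)
      obtain ⟨j, rfl⟩ : ∃ j, u = some j := by
        cases u with
        | none => exact absurd hu hU
        | some j => exact ⟨j, rfl⟩
      refine ⟨e + Pi.single j (-∑ i, e i), fun i hi k => ?_, fun i hi => ?_, fun _ => ?_⟩
      · have hij : i ≠ j := by
          rintro rfl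
          exact hu' hi
        simp [he, hi, Pi.single_eq_of_ne hij]
      · have hij : i ≠ j := by
          rintro rfl
          exact hi hu
        rw [Pi.add_apply, Pi.single_eq_of_ne hij, add_zero]
        exact he0 i fun h => hi (hS h)
      · simp only [Pi.add_apply, Finset.sum_add_distrib]
        rw [Finset.sum_pi_single']
        simp
  · exact ⟨e, fun i hi k => by simp [he, hi], fun i hi => he0 i fun h => hi (hS h),
      fun h => absurd h hagg⟩

theorem answer_shiftTape {qs : List (Query D)} {ch : Challenge D} (b : Bool)
    (K : PaillierKey) {d : Fin D.M → Fin D.na → ZMod (2 ^ D.gam)}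
    (hch : qs.filterMap Query.challenge? = [ch])
    (hS : (ch.S : Set (Option (Fin D.M))) ⊆ uncorrupted qs ch.t)
    (hd : ∀ i, some i ∈ ch.S → ∀ k, d i k = offsetProduct (ch.W b i) (ch.x b i) k -
        offsetProduct (ch.W (!b) i) (ch.x (!b) i) k)
    (hd0 : ∀ i, some i ∉ uncorrupted qs ch.t → d i = 0)
    (hagg : Query.compromise none ∈ qs → ∑ i, d i = 0)
    {tape : Tape D lam K.N} (htape : NoiseInMargin tape) {q : Query D} (hq : q ∈ qs) :
    answer lam K (!b) (shiftTape b ch d tape) q = answer lam K b tape q := by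
  match q with
  | .compromise (some i) =>
    have h0 : d i = 0 := hd0 i fun h => h.1 hq
    simp only [answer, shiftTape, h0, Pi.zero_apply, add_zero, ite_self]
  | .compromise none =>
    have h0 := hagg hq
    simp only [answer]
    congr 1
    funext t k
    simp only [aggShares, shiftTape]
    split_ifs
    · have hk := congrFun h0 k
      rw [Finset.sum_apply, Pi.zero_apply] at hk
      rw [Finset.sum_add_distrib, hk, add_zero]
    · rfl
  | .encrypt i t W x =>
    have hsh : (shiftTape b ch d tape).1 i t = tape.1 i t := by
      funext k
      simp only [shiftTape]
      split_ifs with ht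
      -- An encryption query at the challenge time removes the agent from `U*`.
      · have h0 : d i = 0 := hd0 i fun h => h.2 i rfl (by
          rw [List.mem_filterMap]
          exact ⟨_, hq, by rw [← ht]; rfl⟩)
        rw [h0, Pi.zero_apply, add_zero]
      · rfl
    simp only [answer]
    congr 1
    funext β
    unfold enc
    rw [hsh]
    rfl
  | .challenge ch' =>
    have hmem : ch' ∈ qs.filterMap Query.challenge? := List.mem_filterMap.mpr ⟨_, hq, rfl⟩
    rw [hch, List.mem_singleton] at hmem
    subst hmem
    simp only [answer]
    congr 1
    funext i
    split_ifs with hi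
    · have hr : (shiftTape b ch' d tape).2.2 i = shiftCoins (ch'.W b i) (ch'.W (!b) i)
          (ch'.x b i) (ch'.x (!b) i) (tape.1 i ch'.t) (d i) (tape.2.2 i) := if_pos hi
      rw [hr]
      congr 1
      exact enc_shiftCoins _ _ _ _ (tape.1 i) _ ch'.t (d i) _
        (fun k => if_pos rfl) (hd i hi) (htape i)
    · rfl

theorem exists_tape_injection (K : PaillierKey) (b : Bool) (qs : List (Query D)) :
    ∃ Φ : Tape D lam K.N → Tape D lam K.N, Function.Injective Φ ∧
      (Legitimate qs → ∀ tape, NoiseInMargin tape → ∀ q ∈ qs,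
        answer lam K (!b) (Φ tape) q = answer lam K b tape q) := by
  by_cases h : Legitimate qs
  · obtain ⟨-, -, ch, hch, hS, hsum⟩ := h
    obtain ⟨d, h1, h2, h3⟩ := exists_mask_shift hS hsum b
    exact ⟨shiftTape b ch d, shiftTape_injective b ch d, fun _ tape htape q hq =>
      answer_shiftTape b K hch hS h1 h2 h3 htape hq⟩
  · exact ⟨id, Function.injective_id, fun h' => absurd h' h⟩

/-! ### Counting tapes -/

open Classical in
-- The injection depends on the list of queries, which in an adaptive game depends on the tape. `Ψ`
-- therefore applies to each tape the injection for its own run.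
theorem card_run_le (A : Adversary D lam) (ω : A.Coins) (K : PaillierKey) (b : Bool)
    (P : History D lam K.N → Prop) (hP : ∀ h, P h → Legitimate (h.map Prod.fst)) :
    (Finset.univ.filter fun tape => P (run A ω K b tape A.steps [])).card ≤
      (Finset.univ.filter fun tape => P (run A ω K (!b) tape A.steps [])).card +
        (Finset.univ.filter fun tape : Tape D lam K.N => ¬ NoiseInMargin tape).card := by
  choose Φ hinj hans using exists_tape_injection (D := D) (lam := lam) K b
  set Ψ : Tape D lam K.N → Tape D lam K.N := fun tape =>
    Φ ((run A ω K b tape A.steps []).map Prod.fst) tape with hΨ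
  have hrun : ∀ tape, P (run A ω K b tape A.steps []) → NoiseInMargin tape →
      run A ω K (!b) (Ψ tape) A.steps [] = run A ω K b tape A.steps [] := fun tape h1 h2 =>
    run_congr A ω K A.steps [] (hans _ (hP _ h1) tape h2)
  have hgood : (Finset.univ.filter fun tape => P (run A ω K b tape A.steps []) ∧
      NoiseInMargin tape).card ≤
      (Finset.univ.filter fun tape => P (run A ω K (!b) tape A.steps [])).card := by
    refine Finset.card_le_card_of_injOn Ψ (fun tape ht => ?_) fun tape ht tape' ht' heq => ?_
    · obtain ⟨-, h1, h2⟩ := Finset.mem_filter.mp ht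
      rw [Finset.mem_coe, Finset.mem_filter]
      refine ⟨Finset.mem_univ _, ?_⟩
      rw [hrun tape h1 h2]
      exact h1
    · obtain ⟨-, h1, h2⟩ := Finset.mem_filter.mp ht
      obtain ⟨-, h1', h2'⟩ := Finset.mem_filter.mp ht'
      -- Equal images have equal runs with `!b`, hence equal query lists, so the same injection was
      -- applied to both tapes.
      have h3 : run A ω K b tape A.steps [] = run A ω K b tape' A.steps [] := by
        rw [← hrun tape h1 h2, heq, hrun tape' h1' h2']
      simp only [hΨ] at heq
      rw [h3] at heq
      exact hinj _ heq
  refine le_trans (Finset.card_le_card fun tape ht => ?_)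
    ((Finset.card_union_le _ _).trans (Nat.add_le_add_right hgood _))
  rw [Finset.mem_union, Finset.mem_filter, Finset.mem_filter]
  obtain ⟨-, h1⟩ := Finset.mem_filter.mp ht
  by_cases h2 : NoiseInMargin tape
  · exact Or.inl ⟨Finset.mem_univ _, h1, h2⟩
  · exact Or.inr ⟨Finset.mem_univ _, h2⟩

open Classical in
/-- A coordinate with a lawful update operation is equidistributed. -/
theorem card_filter_mul_card {T Z : Type*} [Fintype T] [Fintype Z] (f : T → Z) (u : Z → T → T)
    (hf : ∀ z t, f (u z t) = z) (hu : ∀ z t, u (f t) (u z t) = t) (p : Z → Prop) :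
    (Finset.univ.filter fun t => p (f t)).card * Fintype.card Z =
      (Finset.univ.filter p).card * Fintype.card T := by
  rw [← Fintype.card_subtype, ← Fintype.card_subtype, ← Fintype.card_prod, ← Fintype.card_prod]
  exact Fintype.card_congr
    { toFun := fun a => (⟨f a.1.1, a.1.2⟩, u a.2 a.1.1)
      invFun := fun a => (⟨u a.1.1 a.2, by rw [hf]; exact a.1.2⟩, f a.2)
      left_inv := fun a => by ext <;> simp [hf, hu]
      right_inv := fun a => by ext <;> simp [hf, hu] }

open Classical in
-- For one slot of one agent, at most 2·`noiseMargin` values are bad, a fraction of at most 6/2^λ of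
-- the range. A union bound over agents and slots gives the rest.
theorem card_not_noiseInMargin_le (N : ℕ) [NeZero N] :
    (Finset.univ.filter fun tape : Tape D lam N => ¬ NoiseInMargin tape).card * 2 ^ lam ≤
      6 * D.M * D.na * Fintype.card (Tape D lam N) := by
  obtain ⟨bad, hbad⟩ : ∃ bad : ∀ i : Fin D.M, Fin (2 ^ D.noiseBits lam i) → Prop, ∀ i z,
      bad i z ↔ ¬ (noiseMargin D i ≤ z.val ∧
        z.val + noiseMargin D i < 2 ^ D.noiseBits lam i) := ⟨_, fun _ _ => Iff.rfl⟩
  have hcard : ∀ i, (Finset.univ.filter (bad i)).card ≤ 2 * noiseMargin D i := fun i => by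
    have hsub : (Finset.univ.filter (bad i)).map Fin.valEmbedding ⊆
        Finset.range (noiseMargin D i) ∪
          Finset.Ico (2 ^ D.noiseBits lam i - noiseMargin D i) (2 ^ D.noiseBits lam i) := by
      intro v hv
      obtain ⟨z, hz, rfl⟩ := Finset.mem_map.mp hv
      have hz := (Finset.mem_filter.mp hz).2
      have := z.2
      simp only [hbad, Fin.valEmbedding_apply, Finset.mem_union, Finset.mem_range,
        Finset.mem_Ico] at hz ⊢
      omega
    rw [← Finset.card_map Fin.valEmbedding]
    refine (Finset.card_le_card hsub).trans ((Finset.card_union_le _ _).trans ?_)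
    rw [Finset.card_range, Nat.card_Ico]
    omega
  have hone : ∀ i k, (Finset.univ.filter fun tape : Tape D lam N =>
      bad i ((tape.2.2 i).2.1 k)).card * 2 ^ lam ≤ 6 * Fintype.card (Tape D lam N) := by
    intro i k
    have h := card_filter_mul_card (T := Tape D lam N) (fun tape => (tape.2.2 i).2.1 k)
      (fun z tape => (tape.1, tape.2.1, Function.update tape.2.2 i
        ((tape.2.2 i).1, Function.update (tape.2.2 i).2.1 k z, (tape.2.2 i).2.2)))
      (fun z t => by simp) (fun z t => by simp) (bad i)
    rw [Fintype.card_fin] at h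
    have hbits : 2 ^ D.noiseBits lam i = 2 ^ (D.l + 1 + Nat.clog 2 (D.n i)) * 2 ^ lam := by
      rw [← pow_add]
      congr 1
      unfold System.noiseBits
      omega
    have hpos : 0 < 2 ^ (D.l + 1 + Nat.clog 2 (D.n i)) := by positivity
    refine Nat.le_of_mul_le_mul_left ?_ hpos
    obtain ⟨X, hX⟩ : ∃ X, X = (Finset.univ.filter fun tape : Tape D lam N =>
      bad i ((tape.2.2 i).2.1 k)).card := ⟨_, rfl⟩
    rw [← hX] at h ⊢
    calc _ = X * 2 ^ D.noiseBits lam i := by rw [hbits]; ring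
      _ = _ := h
      _ ≤ 2 * noiseMargin D i * Fintype.card (Tape D lam N) := Nat.mul_le_mul_right _ (hcard i)
      _ = _ := by unfold noiseMargin; ring
  have hsub : (Finset.univ.filter fun tape : Tape D lam N => ¬ NoiseInMargin tape) ⊆
      (Finset.univ : Finset (Fin D.M × Fin D.na)).biUnion fun a =>
        Finset.univ.filter fun tape : Tape D lam N => bad a.1 ((tape.2.2 a.1).2.1 a.2) := by
    intro tape ht
    have ht := (Finset.mem_filter.mp ht).2
    unfold NoiseInMargin at ht
    simp only [not_forall] at ht
    obtain ⟨i, k, h⟩ := ht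
    exact Finset.mem_biUnion.mpr ⟨(i, k), Finset.mem_univ _,
      Finset.mem_filter.mpr ⟨Finset.mem_univ _, (hbad _ _).mpr h⟩⟩
  calc _ ≤ (∑ a : Fin D.M × Fin D.na, (Finset.univ.filter fun tape : Tape D lam N =>
        bad a.1 ((tape.2.2 a.1).2.1 a.2)).card) * 2 ^ lam :=
        Nat.mul_le_mul_right _ ((Finset.card_le_card hsub).trans Finset.card_biUnion_le)
    _ ≤ ∑ _a : Fin D.M × Fin D.na, 6 * Fintype.card (Tape D lam N) := by
        rw [Finset.sum_mul]
        exact Finset.sum_le_sum fun a _ => hone a.1 a.2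
    _ = _ := by
        rw [Finset.sum_const, Finset.card_univ, Fintype.card_prod, Fintype.card_fin,
          Fintype.card_fin, smul_eq_mul]
        ring

end Game

/-! ## Probabilities -/

/-- An average of numbers within ε of 1/2 is within ε of 1/2. This allows the key and the
adversary's coins to be fixed. -/
theorem abs_bind_sub_half_le {α : Type*} (p : PMF α) (f : α → PMF Bool) {ε : ℝ}
    (hf : ∀ a, |(f a true).toReal - 1 / 2| ≤ ε) :
    |((p.bind f) true).toReal - 1 / 2| ≤ ε := by
  have hsum : ∀ C : ENNReal, ∑' a, p a * C = C := fun C => by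
    rw [ENNReal.tsum_mul_right, PMF.tsum_coe, one_mul]
  have htop : ∀ q : PMF Bool, q true ≠ ⊤ := fun q => PMF.apply_ne_top q true
  have hε : 0 ≤ ε := by
    obtain ⟨a, -⟩ := p.support_nonempty
    exact (abs_nonneg _).trans (hf a)
  rw [abs_le]
  constructor
  · have h : ENNReal.ofReal (1 / 2 - ε) ≤ (p.bind f) true := by
      rw [PMF.bind_apply, ← hsum (ENNReal.ofReal (1 / 2 - ε))]
      refine ENNReal.tsum_le_tsum fun a => mul_le_mul_right ?_ _
      rw [ENNReal.ofReal_le_iff_le_toReal (htop _)]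
      linarith [(abs_le.mp (hf a)).1]
    rw [ENNReal.ofReal_le_iff_le_toReal (htop _)] at h
    linarith
  · have h : (p.bind f) true ≤ ENNReal.ofReal (1 / 2 + ε) := by
      rw [PMF.bind_apply, ← hsum (ENNReal.ofReal (1 / 2 + ε))]
      refine ENNReal.tsum_le_tsum fun a => mul_le_mul_right ?_ _
      rw [← ENNReal.ofReal_toReal (htop (f a))]
      exact ENNReal.ofReal_le_ofReal (by linarith [(abs_le.mp (hf a)).2])
    have := ENNReal.toReal_le_of_le_ofReal (by linarith) h
    linarith

theorem toReal_uniform_bind {α β : Type*} [Fintype α] [Nonempty α] (f : α → PMF β) (y : β) :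
    (((PMF.uniformOfFintype α).bind f) y).toReal =
      (∑ a, (f a y).toReal) / Fintype.card α := by
  rw [PMF.bind_apply, tsum_fintype, ENNReal.toReal_sum
    (fun a _ => ENNReal.mul_ne_top (PMF.apply_ne_top _ _) (PMF.apply_ne_top _ _)), Finset.sum_div]
  refine Finset.sum_congr rfl fun a _ => ?_
  rw [PMF.uniformOfFintype_apply, ENNReal.toReal_mul, ENNReal.toReal_inv, ENNReal.toReal_natCast]
  field_simp

/-! ### From tape counts to the advantage -/

section Game

variable {D : System} {lam : ℕ}

open Classical in
-- In this form a run that breaks the rules contributes nothing to the deviation from 1/2.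
theorem toReal_outcome (P : Prop) (g b : Bool) :
    ((if P then PMF.pure (g == b) else PMF.uniformOfFintype Bool) true).toReal =
      1 / 2 + ((if P ∧ g = b then 1 else 0) - (if P ∧ g = !b then 1 else 0)) / 2 := by
  by_cases hP : P
  · cases g <;> cases b <;> simp [hP, PMF.pure_apply] <;> norm_num
  · simp [hP, PMF.uniformOfFintype_apply]

open Classical in
theorem abs_game_fixed_coins_le (A : Adversary D lam) (ω : A.Coins) (K : PaillierKey) :
    |(((PMF.uniformOfFintype Bool).bind fun b =>
        (PMF.uniformOfFintype (Tape D lam K.N)).bind fun tape =>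
          if Legitimate ((run A ω K b tape A.steps []).map Prod.fst) then
            PMF.pure (A.guess ω K.N (run A ω K b tape A.steps []) == b)
          else PMF.uniformOfFintype Bool) true).toReal - 1 / 2| ≤
      (3 * D.M * D.na : ℕ) * ((2 : ℝ) ^ lam)⁻¹ := by
  set P : Bool → History D lam K.N → Prop := fun g h =>
    Legitimate (h.map Prod.fst) ∧ A.guess ω K.N h = g with hP
  set cnt : Bool → Bool → ℕ := fun g b =>
    (Finset.univ.filter fun tape => P g (run A ω K b tape A.steps [])).card with hcnt
  set B : ℕ := (Finset.univ.filter fun tape : Tape D lam K.N => ¬ NoiseInMargin tape).card with hB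
  set V : ℕ := Fintype.card (Tape D lam K.N) with hV
  have hVpos : (0 : ℝ) < V := by exact_mod_cast Fintype.card_pos
  have hle : ∀ g b, (cnt g b : ℝ) ≤ cnt g (!b) + B := fun g b => by
    have h : cnt g b ≤ cnt g (!b) + B := by
      convert card_run_le A ω K b (P g) fun h hh => hh.1
    exact_mod_cast h
  have hbound : (B : ℝ) * 2 ^ lam ≤ 6 * D.M * D.na * V := by
    exact_mod_cast card_not_noiseInMargin_le (D := D) (lam := lam) K.N
  have hinner : ∀ b, (((PMF.uniformOfFintype (Tape D lam K.N)).bind fun tape =>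
      if Legitimate ((run A ω K b tape A.steps []).map Prod.fst) then
        PMF.pure (A.guess ω K.N (run A ω K b tape A.steps []) == b)
      else PMF.uniformOfFintype Bool) true).toReal =
      1 / 2 + (cnt b b - cnt (!b) b) / (2 * V) := fun b => by
    rw [toReal_uniform_bind]
    simp_rw [toReal_outcome]
    rw [Finset.sum_add_distrib, Finset.sum_const, Finset.card_univ, nsmul_eq_mul,
      ← Finset.sum_div, Finset.sum_sub_distrib, Finset.sum_boole, Finset.sum_boole]
    change ((V : ℝ) * (1 / 2) + ((cnt b b : ℝ) - cnt (!b) b) / 2) / V = _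
    field_simp
  rw [toReal_uniform_bind, Fintype.sum_bool, hinner, hinner, Fintype.card_bool]
  have h1 := hle true true
  have h2 := hle true false
  have h3 := hle false true
  have h4 := hle false false
  simp only [Bool.not_true, Bool.not_false] at h1 h2 h3 h4 ⊢
  -- Regrouped by guess rather than by bit, so that each difference compares the same event under
  -- the two bits and is at most `B`.
  have heq : (1 / 2 + ((cnt true true : ℝ) - cnt false true) / (2 * V) +
      (1 / 2 + ((cnt false false : ℝ) - cnt true false) / (2 * V))) / (2 : ℕ) - 1 / 2 =
      ((cnt true true - cnt true false) + (cnt false false - cnt false true)) / (4 * V) := by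
    push_cast
    field_simp
    ring
  rw [heq]
  have hB' : (B : ℝ) / (2 * V) ≤ (3 * D.M * D.na : ℕ) * ((2 : ℝ) ^ lam)⁻¹ := by
    rw [← div_eq_mul_inv, div_le_div_iff₀ (by positivity) (by positivity)]
    push_cast
    linarith
  refine le_trans ?_ hB'
  rw [abs_div, abs_of_pos (by positivity : (0 : ℝ) < 4 * V),
    div_le_div_iff₀ (by positivity) (by positivity)]
  have habs : |((cnt true true : ℝ) - cnt true false) + (cnt false false - cnt false true)| ≤
      2 * B := abs_le.mpr ⟨by linarith, by linarith⟩
  calc _ ≤ 2 * (B : ℝ) * (2 * V) := mul_le_mul_of_nonneg_right habs (by positivity)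
    _ = _ := by ring

theorem advantage_le (gen : PMF PaillierKey) (A : Adversary D lam) :
    advantage gen A ≤ (3 * D.M * D.na : ℕ) * ((2 : ℝ) ^ lam)⁻¹ := by
  refine abs_bind_sub_half_le _ _ fun K => ?_
  -- The adversary's coins are independent of the bit and the tape, so they can be drawn before
  -- both.
  simp_rw [PMF.bind_comm (PMF.uniformOfFintype (Tape D lam K.N)) A.coins]
  rw [PMF.bind_comm (PMF.uniformOfFintype Bool) A.coins]
  exact abs_bind_sub_half_le _ _ fun ω => abs_game_fixed_coins_le A ω K

end Game

/-! ### Negligible functions and conclusion -/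

theorem Negligible.of_le_const_mul {f g : ℕ → ℝ} (hg : Negligible g) (C : ℕ)
    (hfg : ∀ n, |f n| ≤ C * |g n|) : Negligible f := by
  intro c hc
  -- The extra power of n absorbs the constant once n ≥ C.
  obtain ⟨n₀, h1, h2⟩ := hg (c + 1) (by linarith)
  refine ⟨max n₀ C, h1.trans (le_max_left _ _), fun n hn => ?_⟩
  have hn0 : n₀ ≤ n := (le_max_left _ _).trans hn
  have hnC : (C : ℝ) ≤ n := by exact_mod_cast (le_max_right _ _).trans hn
  have hpos : (0 : ℝ) < n := by exact_mod_cast h1.trans hn0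
  calc |f n| ≤ C * |g n| := hfg n
    _ ≤ n * (n : ℝ) ^ (-(c + 1)) :=
        mul_le_mul hnC (h2 n hn0) (abs_nonneg _) hpos.le
    _ = (n : ℝ) ^ (-c) := by
        rw [← Real.rpow_one_add' hpos.le (by linarith)]
        congr 1
        ring

theorem aggregatorOblivious (D : System) (gen : ℕ → PMF PaillierKey) {lam : ℕ → ℕ}
    (hlam : Negligible fun κ => ((2 : ℝ) ^ lam κ)⁻¹) : AggregatorOblivious D gen lam := by
  intro A
  refine hlam.of_le_const_mul (3 * D.M * D.na) fun κ => ?_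
  have hadv : 0 ≤ advantage (gen κ) (A κ) := abs_nonneg _
  rw [abs_of_nonneg hadv, abs_of_pos (by positivity : (0 : ℝ) < ((2 : ℝ) ^ lam κ)⁻¹)]
  exact advantage_le (gen κ) (A κ)

end PackedWSA

theorem theorem2 (D : System) (gen : ℕ → PMF PaillierKey) (hgen : IsKeyGenerator gen)
    (lam : ℕ → ℕ) (hlam : Negligible fun κ => ((2 : ℝ) ^ lam κ)⁻¹) :
    IsCorrect D gen lam ∧ AggregatorOblivious D gen lam :=
  ⟨isCorrect D gen lam, aggregatorOblivious D gen hlam⟩
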